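/- An \emph{abelian network} $\mathcal N$ on a directed graph $G=(V,E)$ consists of, for each vertex $v$, an input alphabet $A_v$, a state space $Q_v$, commuting transition maps $t_a : Q_v\to Q_v$ $(a\in A_v)$ and message passing functions $o_a^u : Q_v\to A_u^*$ $(a\in A_v,\ (v,u)\in E)$, such that for each initial state, input words that are equal up to permutation produce, for each $u$, output words in $A_u^*$ that are equal up to permutation. Put $A=\bigsqcup_v A_v$ and $Q=\prod_v Q_v$. Processing a letter $a\in A_v$ in a configuration $\mathbf x.\mathbf q$ ($\mathbf x\in\mathbb Z^A$, $\mathbf q\in Q$) replaces $\mathbf q_v$ by $t_a(\mathbf q_v)$ and $\mathbf x$ by $\mathbf x-1_a$ plus the vector counting the letters in the messages $o_a^u(\mathbf q_v)$. A word $w\in A^*$ is \emph{legal} for $\mathbf x.\mathbf q$ if each of its letters $a$ is processed in a configuration whose $a$-coordinate is at least $1$, and \emph{complete} if the final vector is $\le \mathbf 0$. The network \emph{halts on all inputs} if each $\mathbf x.\mathbf q$ with $\mathbf x\in\mathbb N^A$, $\mathbf q\in Q$ has a complete legal word; the final state $\mathbf x\triangleright\triangleright\mathbf q$ then does not depend on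 the choice of this word. The network is \emph{finite} if $V$ and all $A_v$, $Q_v$ are finite. Let $M_v$ be the submonoid of $\mathrm{End}(Q_v)$ generated by $\{t_a\}_{a\in A_v}$. The network is \emph{irreducible} if for every $v$ the set $Q_v$ is nonempty and any $q,q'\in Q_v$ satisfy $mq=m'q'$ for some $m,m'\in M_v$. The \emph{minimal idempotent} of a finite commutative monoid $M$ is the product $e$ of all its idempotents; $eM$ is an abelian group with identity $e$. Let $e_v$ be the minimal idempotent of $M_v$. Each $t_a$ with $a\in A_v$ permutes $e_vQ_v$, so $\mathbb Z^{A_v}$ acts on $e_vQ_v$; let $K_v$ be the kernel of this action. The \emph{total kernel} is $K=\prod_v K_v\subset\mathbb Z^A$. A state $\mathbf q\in Q$ is \emph{locally recurrent} if $\mathbf q_v\in e_vQ_v$ for all $v$. For such $\mathbf q$ and for $\mathbf k\in K\cap\mathbb N^A$, processing $\mathbf k_a$ letters $a$ for every $a\in A$ in the configuration $\mathbf k.\mathbf q$ yields a configuration $P_{\mathbf q}(\mathbf k).\mathbf q$; the map $P_{\mathbf q}$ extends uniquely to a group homomorphism $K\to\mathbb Z^A$. If $\mathcal N$ is finite and irreducible,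 this homomorphism is independent of the locally recurrent state $\mathbf q$; it is the \emph{production map} $P$. Write $I$ for the inclusion $K\hookrightarrow\mathbb Z^A$. \textbf{Theorem.} Let $\mathcal N$ be a finite irreducible abelian network that halts on all inputs. Let $M$ be the (finite, commutative) submonoid of $\mathrm{End}(Q)$ generated by the maps $\tau_a(\mathbf q)=1_a\triangleright\triangleright\mathbf q$, $a\in A$, let $e$ be its minimal idempotent, and let $\mathrm{Crit}\,\mathcal N=eM$ be the critical group. Then the group homomorphism $\phi:\mathbb Z^A\to\mathrm{Crit}\,\mathcal N$ with $\phi(1_a)=e\tau_a$ for all $a\in A$ induces an isomorphism of abelian groups \[ \mathbb Z^A/(I-P)K\;\simeq\;\mathrm{Crit}\,\mathcal N . \] -/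

import Mathlib

noncomputable section

/-! ### Finite commutative monoids and their actions -/

namespace FiniteMonoid

/-- A monoid action is irreducible if the relation `∃ m m', m • x = m' • y` has exactly one
equivalence class. -/
def IsIrreducible (M X : Type*) [CommMonoid M] [MulAction M X] : Prop :=
  Nonempty X ∧ ∀ x y : X, ∃ m m' : M, m • x = m' • y

/-- The minimal idempotent: the product of all idempotents. -/
def minIdem (M : Type*) [CommMonoid M] [Finite M] : M :=
  ∏ f ∈ (Set.toFinite {f : M | f * f = f}).toFinset, f

section

variable {M : Type*} [CommMonoid M] [Finite M]

theorem minIdem_mul_self : minIdem M * minIdem M = minIdem M := by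
  unfold minIdem
  rw [← Finset.prod_mul_distrib]
  refine Finset.prod_congr rfl fun f hf => ?_
  simpa using hf

theorem exists_idem_pow (m : M) : ∃ n : ℕ, m ^ (n + 1) * m ^ (n + 1) = m ^ (n + 1) := by
  obtain ⟨i, j, hne, hij⟩ := Finite.exists_ne_map_eq_of_infinite (fun n : ℕ => m ^ n)
  wlog hlt : i < j generalizing i j
  · exact this j i hne.symm hij.symm (by omega)
  obtain ⟨p, rfl⟩ := Nat.exists_eq_add_of_lt hlt
  have key : ∀ c n : ℕ, i ≤ n → m ^ (n + c * (p + 1)) = m ^ n := by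
    intro c
    induction c with
    | zero => simp
    | succ c ih =>
      intro n hn
      obtain ⟨d, rfl⟩ := Nat.exists_eq_add_of_le hn
      rw [show i + d + (c + 1) * (p + 1) = (i + d + (p + 1)) + c * (p + 1) by ring,
        ih _ (by omega), show i + d + (p + 1) = (i + p + 1) + d by ring, pow_add, pow_add m i d]
      exact congrArg (· * m ^ d) hij.symm
  refine ⟨i * (p + 1) + p, ?_⟩
  rw [← pow_add]
  have := key (i + 1) (i * (p + 1) + p + 1) (by nlinarith)
  rwa [show (i + 1) * (p + 1) = i * (p + 1) + p + 1 by ring] at this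

theorem exists_mul_eq_minIdem (m : M) : ∃ n : M, n * m = minIdem M := by
  obtain ⟨n, hn⟩ := exists_idem_pow m
  have hmem : m ^ (n + 1) ∈ (Set.toFinite {f : M | f * f = f}).toFinset := by simpa using hn
  obtain ⟨c, hc⟩ := Finset.dvd_prod_of_mem (fun f : M => f) hmem
  refine ⟨c * m ^ n, ?_⟩
  unfold minIdem
  rw [hc, mul_assoc, ← pow_succ, mul_comm]

end

/-- The set `eM`, where `e` is the minimal idempotent of `M`. -/
def MinIdeal (M : Type*) [CommMonoid M] [Finite M] : Type _ :=
  {x : M // ∃ m : M, x = minIdem M * m}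

namespace MinIdeal

variable {M : Type*} [CommMonoid M] [Finite M]

theorem ext {x y : MinIdeal M} (h : x.1 = y.1) : x = y := Subtype.ext h

theorem minIdem_mul (x : MinIdeal M) : minIdem M * x.1 = x.1 := by
  obtain ⟨m, hm⟩ := x.2
  rw [hm, ← mul_assoc, minIdem_mul_self]

/-- The element `e * m` of `eM`. -/
def mk (m : M) : MinIdeal M := ⟨minIdem M * m, m, rfl⟩

/-- `eM` is an abelian group under the multiplication of `M`, with identity element `e`. -/
instance : CommGroup (MinIdeal M) where
  mul x y := ⟨x.1 * y.1, x.1 * y.1, by rw [← mul_assoc, minIdem_mul]⟩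
  mul_assoc x y z := ext (mul_assoc x.1 y.1 z.1)
  mul_comm x y := ext (mul_comm x.1 y.1)
  one := ⟨minIdem M, 1, (mul_one _).symm⟩
  one_mul x := ext (minIdem_mul x)
  mul_one x := ext ((mul_comm x.1 (minIdem M)).trans (minIdem_mul x))
  inv x := mk (exists_mul_eq_minIdem x.1).choose
  inv_mul_cancel x := ext <| by
    change minIdem M * (exists_mul_eq_minIdem x.1).choose * x.1 = minIdem M
    rw [mul_assoc, (exists_mul_eq_minIdem x.1).choose_spec, minIdem_mul_self]

/-- The monoid homomorphism `M → eM`, `m ↦ e * m`. -/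
def proj : M →* MinIdeal M where
  toFun := mk
  map_one' := ext (mul_one _)
  map_mul' x y := ext <| by
    change minIdem M * (x * y) = minIdem M * x * (minIdem M * y)
    rw [mul_mul_mul_comm, minIdem_mul_self]

end MinIdeal

/-- The set `eX`, where `e` is the minimal idempotent of a monoid `M` acting on `X`. -/
def RecSet (M X : Type*) [CommMonoid M] [Finite M] [MulAction M X] : Type _ :=
  {x : X // ∃ y : X, x = minIdem M • y}

/-- The action of the group `eM` on the set `eX`. -/
instance (M X : Type*) [CommMonoid M] [Finite M] [MulAction M X] :
    MulAction (MinIdeal M) (RecSet M X) where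
  smul g x := ⟨g.1 • x.1, g.1 • x.1, by rw [← mul_smul, MinIdeal.minIdem_mul]⟩
  one_smul x := Subtype.ext <| by
    obtain ⟨y, hy⟩ := x.2
    change minIdem M • x.1 = x.1
    rw [hy, ← mul_smul, minIdem_mul_self]
  mul_smul g h x := Subtype.ext (mul_smul g.1 h.1 x.1)

end FiniteMonoid

open FiniteMonoid

/-- The group homomorphism `ℤ^A → G` (for `G` abelian) that sends each basis vector `1_a`
to `g a`. -/
def latticeHom {A G : Type*} [Fintype A] [CommGroup G] (g : A → G) : (A → ℤ) →+ Additive G where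
  toFun x := Additive.ofMul (∏ a, g a ^ x a)
  map_zero' := by simp
  map_add' x y := by simp [zpow_add, Finset.prod_mul_distrib]

/-! ### Abelian processors -/

/-- An automaton with input alphabet `I`, state space `Q` and output alphabets `(B u)`:
`trans a` is the state transition `t_a` and `out a u` the message passing function `o_a^u`. -/
structure Processor (I Q : Type*) {U : Type*} (B : U → Type*) where
  trans : I → Function.End Q
  out : I → (u : U) → Q → List (B u)

/-- The word sent to feed `u` when the input word is processed letter by letter from state `q`. -/
def Processor.outWord {I Q U : Type*} {B : U → Type*} (p : Processor I Q B) (u : U) :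
    Q → List I → List (B u)
  | _, [] => []
  | q, a :: w => p.out a u q ++ p.outWord u (p.trans a q) w

/-- An abelian processor: the state transitions commute, and permuting the input word permutes
each output word. -/
structure AbelianProcessor (I Q : Type*) {U : Type*} (B : U → Type*)
    extends Processor I Q B where
  trans_comm : ∀ a b : I, trans a * trans b = trans b * trans a
  out_perm : ∀ (q : Q) (w w' : List I), w.Perm w' → ∀ u : U,
    (toProcessor.outWord u q w).Perm (toProcessor.outWord u q w')

namespace AbelianProcessor

variable {I Q U : Type*} {B : U → Type*} (p : AbelianProcessor I Q B)

/-- The transition monoid: the submonoid of `End Q` generated by the maps `t_a`. -/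
def transMonoid : Submonoid (Function.End Q) := Submonoid.closure (Set.range p.trans)

instance : CommMonoid p.transMonoid :=
  { (inferInstance : Monoid p.transMonoid) with
    mul_comm := by
      have h := Submonoid.isMulCommutative_closure (M := Function.End Q) (s := Set.range p.trans) (by
        rintro _ ⟨a, rfl⟩ _ ⟨b, rfl⟩
        exact p.trans_comm a b)
      exact h.is_comm.comm }

instance [Finite Q] : Finite (Function.End Q) := inferInstanceAs (Finite (Q → Q))

/-- The generator `t_a` of the transition monoid. -/
def gen (a : I) : p.transMonoid := ⟨p.trans a, Submonoid.subset_closure ⟨a, rfl⟩⟩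

/-- A processor is irreducible if the action of its transition monoid on its states is. -/
def IsIrreducible : Prop := FiniteMonoid.IsIrreducible p.transMonoid Q

/-- The action of `ℤ^I` on `eQ` by permutations, in which `1_a` acts as `t_a`. -/
def latticeAction [Fintype I] [Finite Q] :
    (I → ℤ) →+ Additive (Equiv.Perm (RecSet p.transMonoid Q)) :=
  (MonoidHom.toAdditive (MulAction.toPermHom (MinIdeal p.transMonoid)
    (RecSet p.transMonoid Q))).comp (latticeHom fun a => MinIdeal.mk (p.gen a))

/-- The kernel of the action of `ℤ^I` on `eQ`. -/
def kernel [Fintype I] [Finite Q] : AddSubgroup (I → ℤ) := p.latticeAction.ker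

end AbelianProcessor

/-! ### Abelian networks -/

/-- An abelian network on the directed graph `G`, with an abelian processor at each vertex `v`
that has input alphabet `A v`, state space `Q v` and one output feed, with alphabet `A u`, for each
edge from `v` to `u`. -/
structure AbelianNetwork {V : Type*} (G : Digraph V) (A Q : V → Type*) where
  proc : (v : V) → AbelianProcessor (A v) (Q v) (fun u : {u : V // G.Adj v u} => A u.1)

namespace AbelianNetwork

variable {V : Type*} {G : Digraph V} {A Q : V → Type*} (N : AbelianNetwork G A Q)

/-- Each processor is irreducible. -/
def IsIrreducible : Prop := ∀ v, (N.proc v).IsIrreducible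

open Classical in
/-- The vector of letters sent when the processor at `a.1`, in state `s`, processes letter `a`. -/
def sent (a : Σ v, A v) (s : Q a.1) : (Σ v, A v) → ℕ := fun b =>
  if h : G.Adj a.1 b.1 then ((N.proc a.1).out a.2 ⟨b.1, h⟩ s).count b.2 else 0

open Classical in
/-- Processing of one letter `a` in the configuration `x.q`. -/
def step (a : Σ v, A v) (c : ((Σ v, A v) → ℤ) × (∀ v, Q v)) :
    ((Σ v, A v) → ℤ) × (∀ v, Q v) :=
  (c.1 - Pi.single a 1 + fun b => (N.sent a (c.2 a.1) b : ℤ),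
    Function.update c.2 a.1 ((N.proc a.1).trans a.2 (c.2 a.1)))

/-- The result of executing a word, first letter first. -/
def exec : List (Σ v, A v) → ((Σ v, A v) → ℤ) × (∀ v, Q v) → ((Σ v, A v) → ℤ) × (∀ v, Q v)
  | [], c => c
  | a :: w, c => exec w (N.step a c)

/-- A word is legal if each letter is present at the time it is processed. -/
def Legal : List (Σ v, A v) → ((Σ v, A v) → ℤ) × (∀ v, Q v) → Prop
  | [], _ => True
  | a :: w, c => 1 ≤ c.1 a ∧ Legal w (N.step a c)

/-- A word is complete if no letters remain after its execution. -/
def Complete (w : List (Σ v, A v)) (c : ((Σ v, A v) → ℤ) × (∀ v, Q v)) : Prop :=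
  (N.exec w c).1 ≤ 0

/-- Every nonnegative input, in every state, has a finite complete legal execution. -/
def HaltsOnAllInputs : Prop := ∀ (x : (Σ v, A v) → ℕ) (q : ∀ v, Q v),
  ∃ w, N.Legal w (fun a => (x a : ℤ), q) ∧ N.Complete w (fun a => (x a : ℤ), q)

section Abelian

theorem step_fst (a : Σ v, A v) (c : ((Σ v, A v) → ℤ) × (∀ v, Q v)) (b : Σ v, A v)
    [Decidable (b = a)] :
    (N.step a c).1 b = c.1 b - (if b = a then 1 else 0) + N.sent a (c.2 a.1) b := by
  by_cases h : b = a <;> simp [step, h]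

theorem sent_swap (v : V) (a b : A v) (s : Q v) (c : Σ v, A v) :
    N.sent ⟨v, a⟩ s c + N.sent ⟨v, b⟩ ((N.proc v).trans a s) c =
      N.sent ⟨v, b⟩ s c + N.sent ⟨v, a⟩ ((N.proc v).trans b s) c := by
  classical
  by_cases h : G.Adj v c.1
  · have := ((N.proc v).out_perm s [a, b] [b, a] (List.Perm.swap b a []) ⟨c.1, h⟩).count_eq c.2
    simpa [sent, h, Processor.outWord] using this
  · simp [sent, h]

theorem step_swap (a b : Σ v, A v) (c : ((Σ v, A v) → ℤ) × (∀ v, Q v)) :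
    N.step b (N.step a c) = N.step a (N.step b c) := by
  classical
  obtain ⟨v, a⟩ := a
  obtain ⟨u, b⟩ := b
  obtain ⟨x, q⟩ := c
  by_cases huv : u = v
  · subst huv
    refine Prod.ext ?_ ?_
    · funext l
      have h := N.sent_swap u a b (q u) l
      have h' : (N.sent ⟨u, a⟩ (q u) l : ℤ) + N.sent ⟨u, b⟩ ((N.proc u).trans a (q u)) l =
        N.sent ⟨u, b⟩ (q u) l + N.sent ⟨u, a⟩ ((N.proc u).trans b (q u)) l := by exact_mod_cast h
      simp only [step, Function.update_self, Pi.add_apply, Pi.sub_apply]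
      linarith
    · simp only [step, Function.update_self, Function.update_idem]
      exact congrArg _ (congrFun ((N.proc u).trans_comm b a) (q u))
  · refine Prod.ext ?_ ?_
    · funext l
      simp only [step, Pi.add_apply, Pi.sub_apply, Function.update_of_ne huv,
        Function.update_of_ne (Ne.symm huv)]
      ring
    · simp only [step, Function.update_of_ne huv, Function.update_of_ne (Ne.symm huv)]
      exact Function.update_comm (Ne.symm huv) _ _ _

theorem exec_append (w w' : List (Σ v, A v)) (c : ((Σ v, A v) → ℤ) × (∀ v, Q v)) :
    N.exec (w ++ w') c = N.exec w' (N.exec w c) := by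
  induction w generalizing c with
  | nil => rfl
  | cons a w ih => exact ih _

/-- The result of an execution depends only on how often each letter occurs. -/
theorem exec_perm {w w' : List (Σ v, A v)} (h : w.Perm w')
    (c : ((Σ v, A v) → ℤ) × (∀ v, Q v)) : N.exec w c = N.exec w' c := by
  induction h generalizing c with
  | nil => rfl
  | cons a _ ih => exact ih _
  | swap a b l => simp only [exec, N.step_swap a b c]
  | trans _ _ ih ih' => exact (ih c).trans (ih' c)

theorem exec_shift (w : List (Σ v, A v)) (x y : (Σ v, A v) → ℤ) (q : ∀ v, Q v) :
    N.exec w (x + y, q) = ((N.exec w (x, q)).1 + y, (N.exec w (x, q)).2) := by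
  induction w generalizing x q with
  | nil => rfl
  | cons a w ih =>
    have : N.step a (x + y, q) = ((N.step a (x, q)).1 + y, (N.step a (x, q)).2) := by
      refine Prod.ext ?_ rfl
      funext l
      simp only [step, Pi.add_apply, Pi.sub_apply]
      ring
    simp only [exec, this]
    exact ih _ _

theorem le_exec_of_notMem (w : List (Σ v, A v)) (c : ((Σ v, A v) → ℤ) × (∀ v, Q v))
    (a : Σ v, A v) (h : a ∉ w) : c.1 a ≤ (N.exec w c).1 a := by
  classical
  induction w generalizing c with
  | nil => exact le_rfl
  | cons b w ih =>
    rw [List.mem_cons, not_or] at h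
    refine le_trans ?_ (ih (N.step b c) h.2)
    rw [step_fst, if_neg h.1]
    simp

/-- Least action principle: no letter is processed more often in a legal execution than in a
complete one. -/
theorem legal_subperm (w w' : List (Σ v, A v)) (c : ((Σ v, A v) → ℤ) × (∀ v, Q v))
    (hw : N.Legal w c) (hw' : N.Complete w' c) : w.Subperm w' := by
  classical
  induction w generalizing c w' with
  | nil => exact List.nil_subperm
  | cons a w ih =>
    have ha : a ∈ w' := by
      by_contra hn
      have h1 := N.le_exec_of_notMem w' c a hn
      have h2 : (N.exec w' c).1 a ≤ 0 := hw' a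
      have h3 : 1 ≤ c.1 a := hw.1
      omega
    have hp := List.perm_cons_erase ha
    refine (hp.subperm_left).2 ((List.subperm_cons a).2 (ih (w'.erase a) (N.step a c) hw.2 ?_))
    have := N.exec_perm hp c
    unfold Complete at hw' ⊢
    rw [this] at hw'
    exact hw'

theorem legal_shift (w : List (Σ v, A v)) (x y : (Σ v, A v) → ℤ) (q : ∀ v, Q v)
    (hy : 0 ≤ y) (hw : N.Legal w (x, q)) : N.Legal w (x + y, q) := by
  induction w generalizing x q with
  | nil => trivial
  | cons a w ih =>
    have h := N.exec_shift [a] x y q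
    simp only [exec] at h
    refine ⟨?_, ?_⟩
    · have h1 : 1 ≤ x a := hw.1
      have h2 : 0 ≤ y a := hy a
      change 1 ≤ x a + y a
      omega
    · rw [h]
      exact ih _ _ hw.2

theorem legal_append (w w' : List (Σ v, A v)) (c : ((Σ v, A v) → ℤ) × (∀ v, Q v))
    (hw : N.Legal w c) (hw' : N.Legal w' (N.exec w c)) : N.Legal (w ++ w') c := by
  induction w generalizing c with
  | nil => exact hw'
  | cons a w ih => exact ⟨hw.1, ih _ hw.2 hw'⟩

theorem exec_nonneg (w : List (Σ v, A v)) (c : ((Σ v, A v) → ℤ) × (∀ v, Q v))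
    (hc : 0 ≤ c.1) (hw : N.Legal w c) : 0 ≤ (N.exec w c).1 := by
  classical
  induction w generalizing c with
  | nil => exact hc
  | cons a w ih =>
    refine ih _ (fun b => ?_) hw.2
    have h1 : 1 ≤ c.1 a := hw.1
    have h2 : 0 ≤ c.1 b := hc b
    rw [step_fst]
    by_cases h : b = a
    · subst h
      rw [if_pos rfl]
      change (0 : ℤ) ≤ _
      omega
    · rw [if_neg h]
      change (0 : ℤ) ≤ _
      omega

end Abelian

section Global

variable {N} (hN : N.HaltsOnAllInputs)

/-- The global action: the final state reached from the input `x` and the state `q` by a complete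
legal execution. -/
def globalAct (x : (Σ v, A v) → ℕ) (q : ∀ v, Q v) : ∀ v, Q v :=
  (N.exec (hN x q).choose (fun a => (x a : ℤ), q)).2

/-- The final state does not depend on the choice of the complete legal execution. -/
theorem globalAct_eq (x : (Σ v, A v) → ℕ) (q : ∀ v, Q v) (w : List (Σ v, A v))
    (hw : N.Legal w (fun a => (x a : ℤ), q)) (hw' : N.Complete w (fun a => (x a : ℤ), q)) :
    globalAct hN x q = (N.exec w (fun a => (x a : ℤ), q)).2 := by
  obtain ⟨h1, h2⟩ := (hN x q).choose_spec
  exact congrArg Prod.snd (N.exec_perm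
    ((N.legal_subperm _ _ _ h1 hw').antisymm (N.legal_subperm _ _ _ hw h2)) _)

theorem globalAct_add (x y : (Σ v, A v) → ℕ) (q : ∀ v, Q v) :
    globalAct hN (x + y) q = globalAct hN y (globalAct hN x q) := by
  obtain ⟨w, hl, hc⟩ := hN x q
  have hx := globalAct_eq hN x q w hl hc
  obtain ⟨w', hl', hc'⟩ := hN y (globalAct hN x q)
  have hy := globalAct_eq hN y _ w' hl' hc'
  have h0 : (N.exec w (fun a => (x a : ℤ), q)).1 = 0 :=
    le_antisymm hc (N.exec_nonneg _ _ (fun a => Int.natCast_nonneg _) hl)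
  have hxy : (fun a => (((x + y) a : ℕ) : ℤ)) = (fun a => (x a : ℤ)) + fun a => (y a : ℤ) := by
    funext a
    simp
  have he : N.exec w (fun a => (((x + y) a : ℕ) : ℤ), q) =
      (fun a => (y a : ℤ), globalAct hN x q) := by
    rw [hxy, N.exec_shift, h0, zero_add, hx]
  rw [globalAct_eq hN (x + y) q (w ++ w') ?_ ?_, N.exec_append, he, hy]
  · refine N.legal_append _ _ _ ?_ (he ▸ hl')
    rw [hxy]
    exact N.legal_shift _ _ _ _ (fun a => Int.natCast_nonneg _) hl
  · unfold Complete
    rw [N.exec_append, he]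
    exact hc'

open Classical in
/-- The map `τ_a` on states, which adds one letter `a` and runs the network until it halts. -/
def tau (a : Σ v, A v) : Function.End (∀ v, Q v) := fun q => globalAct hN (Pi.single a 1) q

theorem tau_comm (a b : Σ v, A v) : tau hN a * tau hN b = tau hN b * tau hN a := by
  classical
  funext q
  change globalAct hN _ (globalAct hN _ q) = globalAct hN _ (globalAct hN _ q)
  rw [← globalAct_add, ← globalAct_add, add_comm]

/-- The global monoid, generated by the maps `τ_a`. -/
def globalMonoid : Submonoid (Function.End (∀ v, Q v)) := Submonoid.closure (Set.range (tau hN))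

instance : CommMonoid (globalMonoid hN) :=
  { (inferInstance : Monoid (globalMonoid hN)) with
    mul_comm := by
      have h := Submonoid.isMulCommutative_closure (M := Function.End (∀ v, Q v))
        (s := Set.range (tau hN)) (by
        rintro _ ⟨a, rfl⟩ _ ⟨b, rfl⟩
        exact tau_comm hN a b)
      exact h.is_comm.comm }

/-- The generator `τ_a` of the global monoid. -/
def tauGen (a : Σ v, A v) : globalMonoid hN := ⟨tau hN a, Submonoid.subset_closure ⟨a, rfl⟩⟩

/-- The critical group `eM`, where `e` is the minimal idempotent of the global monoid `M`. -/
abbrev Crit [Finite V] [∀ v, Finite (Q v)] : Type _ := MinIdeal (globalMonoid hN)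

/-- The group homomorphism `ℤ^A → Crit N` that sends `1_a` to `e τ_a`. -/
def toCrit [Fintype V] [∀ v, Fintype (A v)] [∀ v, Finite (Q v)] :
    ((Σ v, A v) → ℤ) →+ Additive (Crit hN) :=
  latticeHom fun a => MinIdeal.mk (tauGen hN a)

end Global

/-! ### The total kernel and the production map -/

section Production

/-- A state `q` is locally recurrent if `q_v ∈ e_v Q_v` for all `v`, where `e_v` is the minimal
idempotent of the transition monoid at `v`. -/
def LocallyRecurrent [∀ v, Finite (Q v)] (q : ∀ v, Q v) : Prop :=
  ∀ v, ∃ s : Q v, q v = minIdem (N.proc v).transMonoid • s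

/-- The total kernel `K = ∏ K_v`, as a subgroup of `ℤ^A`. -/
def totalKernel [∀ v, Fintype (A v)] [∀ v, Finite (Q v)] : AddSubgroup ((Σ v, A v) → ℤ) where
  carrier := {x | ∀ v, (fun a => x ⟨v, a⟩) ∈ (N.proc v).kernel}
  zero_mem' v := (N.proc v).kernel.zero_mem
  add_mem' hx hy v := (N.proc v).kernel.add_mem (hx v) (hy v)
  neg_mem' hx v := (N.proc v).kernel.neg_mem (hx v)

theorem exec_snd (w : List (Σ v, A v)) (c : ((Σ v, A v) → ℤ) × (∀ v, Q v)) (v : V)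
    [Fintype (A v)] [DecidableEq (Σ v, A v)] :
    (N.exec w c).2 v = (∏ a : A v, (N.proc v).gen a ^ w.count ⟨v, a⟩) • c.2 v := by
  classical
  induction w generalizing c with
  | nil => simp [exec]
  | cons b w ih =>
    rw [exec, ih]
    obtain ⟨u, b⟩ := b
    by_cases huv : u = v
    · subst huv
      have h1 : (N.step ⟨u, b⟩ c).2 u = (N.proc u).gen b • c.2 u := by
        simp only [step, Function.update_self]
        rfl
      have h2 : ∀ a : A u, List.count (⟨u, a⟩ : Σ v, A v) (⟨u, b⟩ :: w) =
          List.count ⟨u, a⟩ w + if a = b then 1 else 0 := by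
        intro a
        by_cases hab : a = b
        · subst hab
          simp
        · rw [List.count_cons_of_ne, if_neg hab, add_zero]
          intro h
          exact hab (by simpa using h.symm)
      simp_rw [h1, h2, pow_add, Finset.prod_mul_distrib, pow_ite, pow_one, pow_zero,
        Finset.prod_ite_eq' Finset.univ b, if_pos (Finset.mem_univ b), mul_smul]
    · have h1 : (N.step ⟨u, b⟩ c).2 v = c.2 v := by
        simp only [step]
        exact Function.update_of_ne (Ne.symm huv) _ _
      have h2 : ∀ a : A v, List.count (⟨v, a⟩ : Σ v, A v) (⟨u, b⟩ :: w) =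
          List.count ⟨v, a⟩ w := by
        intro a
        rw [List.count_cons_of_ne]
        intro h
        exact huv (congrArg Sigma.fst h)
      simp_rw [h1, h2]

theorem kernel_smul [∀ v, Fintype (A v)] [∀ v, Finite (Q v)] {q : ∀ v, Q v}
    (hq : N.LocallyRecurrent q) (k : (Σ v, A v) → ℕ)
    (hk : (fun a => (k a : ℤ)) ∈ N.totalKernel) (v : V) :
    (∏ a : A v, (N.proc v).gen a ^ k ⟨v, a⟩) • q v = q v := by
  obtain ⟨r, hr⟩ : ∃ r : RecSet (N.proc v).transMonoid (Q v), r.1 = q v := ⟨⟨q v, hq v⟩, rfl⟩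
  have h : (∏ a : A v, (MinIdeal.mk ((N.proc v).gen a)) ^ ((k ⟨v, a⟩ : ℕ) : ℤ)) • r = r :=
    Equiv.congr_fun (congrArg Additive.toMul ((AddMonoidHom.mem_ker).1 (hk v))) r
  have h2 : (∏ a : A v, (MinIdeal.mk ((N.proc v).gen a)) ^ ((k ⟨v, a⟩ : ℕ) : ℤ)) =
      MinIdeal.proj (∏ a : A v, (N.proc v).gen a ^ k ⟨v, a⟩) := by
    rw [map_prod]
    refine Finset.prod_congr rfl fun a _ => ?_
    rw [zpow_natCast, map_pow]
    rfl
  rw [h2] at h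
  have h3 : (minIdem (N.proc v).transMonoid * ∏ a : A v, (N.proc v).gen a ^ k ⟨v, a⟩) • r.1
      = r.1 := congrArg Subtype.val h
  rw [hr] at h3
  obtain ⟨s, hs⟩ := hq v
  rwa [mul_comm, mul_smul, hs, ← mul_smul (minIdem _) (minIdem _), minIdem_mul_self, ← hs] at h3

variable [Fintype V] [∀ v, Fintype (A v)]

/-- A word in which each letter `a` occurs `x a` times. -/
def wordOf (x : (Σ v, A v) → ℕ) : List (Σ v, A v) :=
  (∑ a, Multiset.replicate (x a) a).toList

/-- The local action: `x ▷ (y.q)` is the result of executing a word with letter counts `x`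
in the configuration `(x + y).q`. -/
def localAct (x : (Σ v, A v) → ℕ) (c : ((Σ v, A v) → ℤ) × (∀ v, Q v)) :
    ((Σ v, A v) → ℤ) × (∀ v, Q v) :=
  N.exec (wordOf x) ((fun a => (x a : ℤ)) + c.1, c.2)

theorem count_wordOf [DecidableEq (Σ v, A v)] (x : (Σ v, A v) → ℕ) (a : Σ v, A v) :
    (wordOf x).count a = x a := by
  rw [wordOf, ← Multiset.coe_count, Multiset.coe_toList, Multiset.count_sum']
  simp [Multiset.count_replicate]

theorem localAct_zero (x : (Σ v, A v) → ℕ) (q : ∀ v, Q v) :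
    N.localAct x (0, q) = N.exec (wordOf x) (fun a => (x a : ℤ), q) := by
  simp [localAct]

variable [∀ v, Finite (Q v)] {q : ∀ v, Q v}

theorem localAct_snd (hq : N.LocallyRecurrent q) (k : (Σ v, A v) → ℕ)
    (hk : (fun a => (k a : ℤ)) ∈ N.totalKernel) : (N.localAct k (0, q)).2 = q := by
  classical
  funext v
  rw [localAct_zero, exec_snd]
  simp_rw [count_wordOf]
  exact N.kernel_smul hq k hk v

theorem localAct_add (hq : N.LocallyRecurrent q) (k l : (Σ v, A v) → ℕ)
    (hk : (fun a => (k a : ℤ)) ∈ N.totalKernel) :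
    (N.localAct (k + l) (0, q)).1 = (N.localAct k (0, q)).1 + (N.localAct l (0, q)).1 := by
  classical
  have hp : (wordOf (k + l)).Perm (wordOf k ++ wordOf l) := by
    rw [List.perm_iff_count]
    intro a
    simp [count_wordOf]
  have hkl : (fun a => (((k + l) a : ℕ) : ℤ)) = (fun a => (k a : ℤ)) + fun a => (l a : ℤ) := by
    funext a
    simp
  have h2 := N.localAct_snd hq k hk
  rw [localAct_zero] at h2
  simp only [localAct_zero]
  rw [N.exec_perm hp, N.exec_append, hkl, N.exec_shift, h2, add_comm _ (fun a => (l a : ℤ)),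
    N.exec_shift, add_comm]

theorem exists_diff (k : (Σ v, A v) → ℤ) (hk : k ∈ N.totalKernel) :
    ∃ l m : (Σ v, A v) → ℕ, (fun a => (l a : ℤ)) ∈ N.totalKernel ∧
      (fun a => (m a : ℤ)) ∈ N.totalKernel ∧ k = (fun a => (l a : ℤ)) - fun a => (m a : ℤ) := by
  have hfin : ∀ v, Finite (Equiv.Perm (RecSet (N.proc v).transMonoid (Q v))) := by
    intro v
    have : Finite (RecSet (N.proc v).transMonoid (Q v)) :=
      inferInstanceAs (Finite {x : Q v // ∃ y : Q v, x = minIdem (N.proc v).transMonoid • y})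
    infer_instance
  set c : V → ℕ := fun v => Nat.card (Equiv.Perm (RecSet (N.proc v).transMonoid (Q v)))
  set n : ℕ := ∏ v, c v
  have hn : 1 ≤ n := Finset.prod_pos fun v _ => Nat.card_pos
  have hK : ∀ x : (Σ v, A v) → ℤ, n • x ∈ N.totalKernel := by
    intro x v
    obtain ⟨d, hd⟩ : c v ∣ n := Finset.dvd_prod_of_mem c (Finset.mem_univ v)
    change n • (fun a => x ⟨v, a⟩) ∈ (N.proc v).latticeAction.ker
    rw [AddMonoidHom.mem_ker, map_nsmul, hd, mul_comm, mul_nsmul']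
    have : c v • (N.proc v).latticeAction (fun a => x ⟨v, a⟩) = 0 :=
      congrArg Additive.ofMul (pow_card_eq_one' (x := Additive.toMul
        ((N.proc v).latticeAction (fun a => x ⟨v, a⟩))))
    rw [this, nsmul_zero]
  have hm : (fun a => ((n * (k a).natAbs : ℕ) : ℤ)) ∈ N.totalKernel := by
    have := hK fun a => ((k a).natAbs : ℤ)
    convert this using 1
    funext a
    simp
  have hnn : ∀ a, 0 ≤ k a + ((n * (k a).natAbs : ℕ) : ℤ) := by
    intro a
    have h1 : (k a).natAbs ≤ n * (k a).natAbs := Nat.le_mul_of_pos_left _ hn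
    omega
  have hl : (fun a => (((k a + ((n * (k a).natAbs : ℕ) : ℤ)).toNat : ℕ) : ℤ)) =
      k + fun a => ((n * (k a).natAbs : ℕ) : ℤ) := by
    funext a
    exact Int.toNat_of_nonneg (hnn a)
  refine ⟨fun a => (k a + ((n * (k a).natAbs : ℕ) : ℤ)).toNat, fun a => n * (k a).natAbs,
    ?_, hm, ?_⟩
  · rw [hl]
    exact N.totalKernel.add_mem hk hm
  · rw [hl, add_sub_cancel_right]

/-- For locally recurrent `q`, the map `P_q` on `K ∩ ℕ^A` given by `k ▷ q = P_q(k).q` extends to a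
group homomorphism on `K`. -/
theorem exists_production (hq : N.LocallyRecurrent q) :
    ∃ P : N.totalKernel →+ ((Σ v, A v) → ℤ), ∀ (k : (Σ v, A v) → ℕ)
      (hk : (fun a => (k a : ℤ)) ∈ N.totalKernel), N.localAct k (0, q) = (P ⟨_, hk⟩, q) := by
  choose l m hl hm hlm using fun k : N.totalKernel => N.exists_diff k.1 k.2
  have key : ∀ x y z t : (Σ v, A v) → ℕ, (fun a => (x a : ℤ)) ∈ N.totalKernel →
      (fun a => (z a : ℤ)) ∈ N.totalKernel → x + y = z + t →
      (N.localAct x (0, q)).1 + (N.localAct y (0, q)).1 =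
        (N.localAct z (0, q)).1 + (N.localAct t (0, q)).1 := by
    intro x y z t hx hz h
    rw [← N.localAct_add hq x y hx, h, N.localAct_add hq z t hz]
  refine ⟨AddMonoidHom.mk' (fun k => (N.localAct (l k) (0, q)).1 - (N.localAct (m k) (0, q)).1)
    ?_, ?_⟩
  · intro x y
    have hmem : ∀ x y : (Σ v, A v) → ℕ, (fun a => (x a : ℤ)) ∈ N.totalKernel →
        (fun a => (y a : ℤ)) ∈ N.totalKernel →
        (fun a => (((x + y) a : ℕ) : ℤ)) ∈ N.totalKernel := by
      intro x y hx hy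
      convert N.totalKernel.add_mem hx hy using 1
      funext a
      simp
    have h := key (l (x + y)) (m x + m y) (l x + l y) (m (x + y)) (hl _)
      (hmem _ _ (hl x) (hl y)) (by
        funext a
        have h1 := congrFun (hlm x) a
        have h2 := congrFun (hlm y) a
        have h3 := congrFun (hlm (x + y)) a
        simp only [AddSubgroup.coe_add, Pi.add_apply, Pi.sub_apply] at h1 h2 h3
        simp only [Pi.add_apply]
        omega)
    rw [N.localAct_add hq _ _ (hm x), N.localAct_add hq _ _ (hl x)] at h
    rw [sub_add_sub_comm, sub_eq_sub_iff_add_eq_add]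
    exact h
  · intro k hk
    refine Prod.ext ?_ (N.localAct_snd hq k hk)
    have h := key k (m ⟨_, hk⟩) (l ⟨_, hk⟩) 0 hk (hl _) (by
      funext a
      have h1 := congrFun (hlm ⟨_, hk⟩) a
      simp only [Pi.sub_apply] at h1
      simp only [Pi.add_apply, Pi.zero_apply]
      omega)
    have h0 : (N.localAct 0 (0, q)).1 = 0 := by
      have := N.localAct_add hq 0 0 (by
        convert N.totalKernel.zero_mem using 1
        funext a
        simp)
      simpa using this
    rw [h0, add_zero] at h
    exact eq_sub_of_add_eq h

/-- The production map `P = P_q : K → ℤ^A`: the group homomorphism with `k ▷ q = P(k).q` for all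
`k ∈ K ∩ ℕ^A`. It is determined by this property, since `K` is generated by `K ∩ ℕ^A`. -/
def production (hq : N.LocallyRecurrent q) : N.totalKernel →+ ((Σ v, A v) → ℤ) :=
  (N.exists_production hq).choose

end Production

end AbelianNetwork

end

/-! The critical group records inputs up to their effect on recurrent states. Every element of `eM`
is `e` times a product of maps `τ_a`, so `φ` is onto, and the content is the equality `ker φ = (I -
P)K`.

Irreducibility enters through one rigidity fact, `minIdem_mul_smul_eq`: two elements of a finite
commutative monoid that agree at a single point of an irreducible action agree everywhere after
multiplication by `e`. It applies at each vertex and, since irreducibility passes from the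
processors to the global action, also to `M`.

For `(I - P)K ⊆ ker φ`, let `k ∈ K ∩ ℕ^A`. Processing `k` at the locally recurrent `q` is legal,
returns to `q` and leaves `P(k)`. Hence `k` and `P(k)` drive `q` to the same final state, and global
rigidity gives `φ(k) = φ(P(k))`.

Conversely let `φ(x) = φ(y)`, and let `z` be an input that acts as `e`. Then `z + x` and `z + y`
take `q` to the same final state through complete legal words `w` and `w'`. Local rigidity puts the
difference of their letter counts in `K`; write it as `l - m` with `l, m ∈ K ∩ ℕ^A`. The words `m w`
and `l w'` are permutations of each other, so they change the letter vector equally: `P(m) - (z + x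
+ m) = P(l) - (z + y + l)`, that is, `x - y = (I - P)(l - m)`. -/

/-! ### Rigidity of irreducible actions -/

namespace FiniteMonoid

/-- If two elements of a finite commutative monoid agree at one point of an irreducible action,
then they agree everywhere after multiplication by the minimal idempotent. -/
theorem IsIrreducible.minIdem_mul_smul_eq {M X : Type*} [CommMonoid M] [Finite M] [MulAction M X]
    (h : IsIrreducible M X) {m m' : M} {x : X} (hx : m • x = m' • x) (y : X) :
    (minIdem M * m) • y = (minIdem M * m') • y := by
  obtain ⟨n, n', hn⟩ := h.2 y x
  obtain ⟨c, hc⟩ := exists_mul_eq_minIdem n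
  -- Since `e = c * n`, commutativity brings `n` next to `y`, where it turns into `n'` at `x`. The
  -- resulting factor `c * n'` does not depend on `l`.
  have key : ∀ l : M, (minIdem M * l) • y = (c * n') • l • x := by
    intro l
    rw [← hc, mul_right_comm, mul_smul, hn, ← mul_smul, ← mul_smul, mul_right_comm]
  rw [key, key, hx]

/-- On `ℕ^A`, the homomorphism `1_a ↦ e * g a` is the projection of a product in the monoid. -/
theorem latticeHom_mk_natCast {A M : Type*} [Fintype A] [CommMonoid M] [Finite M] (g : A → M)
    (x : A → ℕ) : latticeHom (fun a => MinIdeal.mk (g a)) (fun a => (x a : ℤ)) =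
      Additive.ofMul (MinIdeal.proj (∏ a, g a ^ x a)) := by
  refine congrArg Additive.ofMul (Eq.trans (Finset.prod_congr rfl fun a _ => ?_)
    (map_prod MinIdeal.proj _ _).symm)
  rw [zpow_natCast, map_pow]
  rfl

end FiniteMonoid

/-! ### Single processors: kernel and transition monoid -/

open FiniteMonoid

/-- Two inputs in `ℕ^I` that lead from one state to the same state of an irreducible processor
differ by an element of the kernel. -/
theorem AbelianProcessor.IsIrreducible.sub_mem_kernel {I Q U : Type*} {B : U → Type*}
    {p : AbelianProcessor I Q B} [Fintype I] [Finite Q] (hp : p.IsIrreducible) {x y : I → ℕ}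
    {s : Q} (h : (∏ a, p.gen a ^ x a) • s = (∏ a, p.gen a ^ y a) • s) :
    ((fun a => (x a : ℤ)) - fun a => (y a : ℤ)) ∈ p.kernel := by
  refine AddMonoidHom.mem_ker.2 ?_
  rw [map_sub, sub_eq_zero]
  simp only [latticeAction, AddMonoidHom.comp_apply, latticeHom_mk_natCast]
  -- Two permutations of `eQ` are compared pointwise; agreement at `s`, which need not lie in `eQ`,
  -- suffices by rigidity.
  refine congrArg Additive.ofMul (Equiv.ext fun r => Subtype.ext ?_)
  exact hp.minIdem_mul_smul_eq h r.1

/-- The generators commute, so only letter counts matter. The closure is first moved from `End` into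
the submonoid itself, because products of powers are taken there. -/
theorem AbelianProcessor.exists_prod_gen_eq {I S U : Type*} {B : U → Type*} [Fintype I]
    (p : AbelianProcessor I S B) (m : p.transMonoid) : ∃ x : I → ℕ, ∏ a, p.gen a ^ x a = m := by
  have h : m ∈ Submonoid.closure (Set.range p.gen) := by
    have hr : Set.range p.gen = Subtype.val ⁻¹' Set.range p.trans := by
      ext f
      simp only [Set.mem_range, Set.mem_preimage, Subtype.ext_iff]
      rfl
    rw [hr]
    exact (Submonoid.closure_closure_coe_preimage (s := Set.range p.trans)).ge (Submonoid.mem_top m)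
  obtain ⟨x, hx⟩ := Submonoid.exists_of_mem_closure_range _ _ h
  exact ⟨x, hx.symm⟩

/-! ### Legality and the total kernel -/

namespace AbelianNetwork

variable {V : Type*} {G : Digraph V} {A Q : V → Type*} (N : AbelianNetwork G A Q)

/-- Only processing `a` consumes an `a`, and messages only add letters, so a sufficient initial
supply never runs out. -/
theorem legal_of_count_le [DecidableEq (Σ v, A v)] (w : List (Σ v, A v))
    (c : ((Σ v, A v) → ℤ) × (∀ v, Q v)) (h : ∀ a, (w.count a : ℤ) ≤ c.1 a) : N.Legal w c := by
  induction w generalizing c with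
  | nil => trivial
  | cons b w ih =>
    refine ⟨?_, ih _ fun a => ?_⟩
    · have := h b
      rw [List.count_cons_self] at this
      push_cast at this
      linarith [Int.natCast_nonneg (w.count b)]
    · have := h a
      rw [step_fst]
      by_cases hab : a = b
      · subst hab
        rw [List.count_cons_self] at this
        push_cast at this
        rw [if_pos rfl]
        linarith [Int.natCast_nonneg (N.sent a (c.2 a.1) a)]
      · rw [List.count_cons_of_ne (Ne.symm hab)] at this
        rw [if_neg hab]
        linarith [Int.natCast_nonneg (N.sent b (c.2 b.1) a)]

/-- Inputs with the same local effect on one state differ by an element of the total kernel. -/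
theorem IsIrreducible.sub_mem_totalKernel {N : AbelianNetwork G A Q} [∀ v, Fintype (A v)]
    [∀ v, Finite (Q v)] (hirr : N.IsIrreducible) {x y : (Σ v, A v) → ℕ}
    {q : ∀ v, Q v} (h : ∀ v, (∏ a : A v, (N.proc v).gen a ^ x ⟨v, a⟩) • q v =
      (∏ a : A v, (N.proc v).gen a ^ y ⟨v, a⟩) • q v) :
    ((fun a => (x a : ℤ)) - fun a => (y a : ℤ)) ∈ N.totalKernel :=
  fun v => AbelianProcessor.IsIrreducible.sub_mem_kernel (hirr v) (h v)

/-! ### Inputs as elements of the global monoid -/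

section Global

variable {N} (hN : N.HaltsOnAllInputs)

theorem globalAct_zero (q : ∀ v, Q v) : globalAct hN 0 q = q := by
  rw [globalAct_eq hN 0 q [] trivial (fun a => by simp [exec])]
  rfl

/-- A legal execution does not change the final state. -/
theorem globalAct_eq_of_legal {x y : (Σ v, A v) → ℕ} {q r : ∀ v, Q v} {w : List (Σ v, A v)}
    (hw : N.Legal w (fun a => (x a : ℤ), q))
    (h : N.exec w (fun a => (x a : ℤ), q) = (fun a => (y a : ℤ), r)) :
    globalAct hN x q = globalAct hN y r := by
  obtain ⟨w', hl, hc⟩ := hN y r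
  rw [globalAct_eq hN y r w' hl hc, globalAct_eq hN x q (w ++ w')
    (N.legal_append _ _ _ hw (h ▸ hl)) ?_, exec_append, h]
  unfold Complete
  rwa [exec_append, h]

theorem tauGen_pow_smul [DecidableEq (Σ v, A v)] (a : Σ v, A v) (n : ℕ) (q : ∀ v, Q v) :
    tauGen hN a ^ n • q = globalAct hN (Pi.single a n) q := by
  induction n with
  | zero => rw [pow_zero, one_smul, Pi.single_zero, globalAct_zero]
  | succ n ih =>
    rw [pow_succ', mul_smul, ih, Pi.single_add, globalAct_add]
    change globalAct hN _ _ = _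
    -- The two sides differ only in the decidable equality inside `Pi.single`: `tau` uses the
    -- classical one.
    congr!

variable [Fintype V] [∀ v, Fintype (A v)]

/-- By `globalAct_add`, inserting the letters one by one and halting in between gives the same final
state as inserting them all at once. This translates between identities in the monoid and
executions. -/
theorem prod_tauGen_smul (x : (Σ v, A v) → ℕ) (q : ∀ v, Q v) :
    (∏ a, tauGen hN a ^ x a) • q = globalAct hN x q := by
  classical
  have key : ∀ s : Finset (Σ v, A v), (∏ a ∈ s, tauGen hN a ^ x a) • q =
      globalAct hN (∑ a ∈ s, Pi.single a (x a)) q := by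
    intro s
    induction s using Finset.induction_on with
    | empty => rw [Finset.prod_empty, Finset.sum_empty, one_smul, globalAct_zero]
    | insert a s ha ih =>
      rw [Finset.prod_insert ha, Finset.sum_insert ha, mul_smul, ih, tauGen_pow_smul,
        ← globalAct_add, add_comm]
  rw [key, Finset.univ_sum_single]

theorem exists_prod_tauGen_eq (m : globalMonoid hN) :
    ∃ x : (Σ v, A v) → ℕ, ∏ a, tauGen hN a ^ x a = m := by
  have h : m ∈ Submonoid.closure (Set.range (tauGen hN)) := by
    have hr : Set.range (tauGen hN) = Subtype.val ⁻¹' Set.range (tau hN) := by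
      ext f
      simp only [Set.mem_range, Set.mem_preimage, Subtype.ext_iff]
      rfl
    rw [hr]
    exact (Submonoid.closure_closure_coe_preimage (s := Set.range (tau hN))).ge (Submonoid.mem_top m)
  obtain ⟨x, hx⟩ := Submonoid.exists_of_mem_closure_range _ _ h
  exact ⟨x, hx.symm⟩

/-- Processing an input locally from `x.q` is a legal execution, which leaves letters `y`. -/
theorem exists_localAct_eq (x : (Σ v, A v) → ℕ) (q : ∀ v, Q v) :
    ∃ y : (Σ v, A v) → ℕ, (N.localAct x (0, q)).1 = (fun a => (y a : ℤ)) ∧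
      ∀ z, globalAct hN (x + z) q = globalAct hN (y + z) (N.localAct x (0, q)).2 := by
  classical
  have hl : N.Legal (wordOf x) (fun a => (x a : ℤ), q) :=
    N.legal_of_count_le _ _ fun a => by rw [count_wordOf]
  have h0 := N.exec_nonneg _ _ (fun a => Int.natCast_nonneg _) hl
  rw [← localAct_zero] at h0
  have hy : (N.localAct x (0, q)).1 = fun a => (((N.localAct x (0, q)).1 a).toNat : ℤ) :=
    funext fun a => (Int.toNat_of_nonneg (h0 a)).symm
  refine ⟨_, hy, fun z => ?_⟩
  have hcast : ∀ u : (Σ v, A v) → ℕ, (fun a => (((u + z) a : ℕ) : ℤ)) =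
      (fun a => (u a : ℤ)) + fun a => (z a : ℤ) := fun u => funext fun a => by simp
  -- The extra letters `z` stay untouched: adding them preserves legality and shifts the remaining
  -- letters by `z`.
  refine globalAct_eq_of_legal hN (w := wordOf x) ?_ ?_
  · rw [hcast]
    exact N.legal_shift _ _ _ _ (fun a => Int.natCast_nonneg _) hl
  · rw [hcast, hcast, exec_shift, ← localAct_zero, ← hy]

end Global

/-! ### The map to the critical group and its kernel -/

section Irreducible

variable [Fintype V] [∀ v, Fintype (A v)] {N}

theorem localAct_snd_apply (x : (Σ v, A v) → ℕ) (q : ∀ v, Q v) (v : V) :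
    (N.localAct x (0, q)).2 v = (∏ a : A v, (N.proc v).gen a ^ x ⟨v, a⟩) • q v := by
  classical
  rw [localAct_zero, exec_snd]
  simp_rw [count_wordOf]

/-- The global action of an irreducible network is irreducible. -/
theorem IsIrreducible.globalMonoid (hirr : N.IsIrreducible) (hN : N.HaltsOnAllInputs) :
    FiniteMonoid.IsIrreducible (globalMonoid hN) (∀ v, Q v) := by
  refine ⟨⟨fun v => (hirr v).1.some⟩, fun q r => ?_⟩
  have h : ∀ v, ∃ x y : A v → ℕ, (∏ a, (N.proc v).gen a ^ x a) • q v =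
      (∏ a, (N.proc v).gen a ^ y a) • r v := by
    intro v
    obtain ⟨m, m', hm⟩ := (hirr v).2 (q v) (r v)
    obtain ⟨x, rfl⟩ := (N.proc v).exists_prod_gen_eq m
    obtain ⟨y, rfl⟩ := (N.proc v).exists_prod_gen_eq m'
    exact ⟨x, y, hm⟩
  choose x y hxy using h
  obtain ⟨x', -, hx⟩ := exists_localAct_eq hN (fun a => x a.1 a.2) q
  obtain ⟨y', -, hy⟩ := exists_localAct_eq hN (fun a => y a.1 a.2) r
  have hs : (N.localAct (fun a => x a.1 a.2) (0, q)).2 =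
      (N.localAct (fun a => y a.1 a.2) (0, r)).2 := by
    funext v
    rw [localAct_snd_apply, localAct_snd_apply]
    exact hxy v
  -- Each side is also given the letters left over by the other, so that both executions pass
  -- through the same state with remaining letters `x' + y'`.
  refine ⟨_, _, (prod_tauGen_smul hN ((fun a => x a.1 a.2) + y') q).trans
    (Eq.trans ?_ (prod_tauGen_smul hN ((fun a => y a.1 a.2) + x') r).symm)⟩
  rw [hx, hy, hs, add_comm]

variable [∀ v, Finite (Q v)]

theorem toCrit_natCast (hN : N.HaltsOnAllInputs) (x : (Σ v, A v) → ℕ) :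
    toCrit hN (fun a => (x a : ℤ)) =
      Additive.ofMul (MinIdeal.proj (∏ a, tauGen hN a ^ x a)) :=
  latticeHom_mk_natCast _ x

/-- Inverses are not needed: an element `e * m` is already the image of a vector in `ℕ^A`, the
exponents of `m` in the generators. -/
theorem toCrit_surjective (hN : N.HaltsOnAllInputs) : Function.Surjective (toCrit hN) := by
  intro g
  obtain ⟨m, hm⟩ := (Additive.toMul g).2
  obtain ⟨x, rfl⟩ := exists_prod_tauGen_eq hN m
  exact ⟨_, (toCrit_natCast hN x).trans (congrArg Additive.ofMul (MinIdeal.ext hm.symm))⟩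

/-- Inputs that lead from one state to the same final state have the same image in `Crit N`. -/
theorem toCrit_eq_of_globalAct_eq (hirr : N.IsIrreducible) (hN : N.HaltsOnAllInputs)
    {x y : (Σ v, A v) → ℕ} {q : ∀ v, Q v} (h : globalAct hN x q = globalAct hN y q) :
    toCrit hN (fun a => (x a : ℤ)) = toCrit hN (fun a => (y a : ℤ)) := by
  rw [toCrit_natCast, toCrit_natCast]
  rw [← prod_tauGen_smul, ← prod_tauGen_smul] at h
  refine congrArg Additive.ofMul (MinIdeal.ext (Subtype.ext (funext fun r => ?_)))
  exact (hirr.globalMonoid hN).minIdem_mul_smul_eq h r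

/-- Inputs with the same image in `Crit N` lead to the same final state once a suitable common input
is added to both. -/
theorem exists_globalAct_eq_of_toCrit_eq (hN : N.HaltsOnAllInputs) {x y : (Σ v, A v) → ℕ}
    (h : toCrit hN (fun a => (x a : ℤ)) = toCrit hN (fun a => (y a : ℤ))) (q : ∀ v, Q v) :
    ∃ z, globalAct hN (z + x) q = globalAct hN (z + y) q := by
  -- The input `z` acts as the minimal idempotent, which absorbs the difference between `x` and `y`.
  obtain ⟨z, hz⟩ := exists_prod_tauGen_eq hN (minIdem (globalMonoid hN))
  rw [toCrit_natCast, toCrit_natCast] at h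
  have h' : minIdem (globalMonoid hN) * (∏ a, tauGen hN a ^ x a) =
      minIdem (globalMonoid hN) * (∏ a, tauGen hN a ^ y a) :=
    congrArg Subtype.val (Additive.ofMul.injective h)
  refine ⟨z, ?_⟩
  simp only [← prod_tauGen_smul, Pi.add_apply, pow_add, Finset.prod_mul_distrib, hz, h']

variable {q : ∀ v, Q v} (hq : N.LocallyRecurrent q)

theorem localAct_eq_production (k : (Σ v, A v) → ℕ)
    (hk : (fun a => (k a : ℤ)) ∈ N.totalKernel) :
    N.localAct k (0, q) = (N.production hq ⟨_, hk⟩, q) :=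
  (N.exists_production hq).choose_spec k hk

/-- For `k` in `K ∩ ℕ^A`, local processing returns to `q` with `P(k)` left over, so `k` and `P(k)`
are interchangeable inputs at `q`. Differences of such `k` exhaust `K`. -/
theorem toCrit_production (hirr : N.IsIrreducible) (hN : N.HaltsOnAllInputs)
    (k : N.totalKernel) : toCrit hN (N.production hq k) = toCrit hN k := by
  have key : ∀ (l : (Σ v, A v) → ℕ) (hl : (fun a => (l a : ℤ)) ∈ N.totalKernel),
      toCrit hN (N.production hq ⟨_, hl⟩) = toCrit hN (fun a => (l a : ℤ)) := by
    intro l hl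
    obtain ⟨y, hy, h⟩ := exists_localAct_eq hN l q
    have h := h 0
    rw [localAct_eq_production hq l hl] at hy h
    simp only at hy
    rw [hy]
    rw [add_zero, add_zero] at h
    exact toCrit_eq_of_globalAct_eq hirr hN h.symm
  obtain ⟨l, m, hl, hm, hk⟩ := N.exists_diff k.1 k.2
  obtain rfl : k = ⟨_, hl⟩ - ⟨_, hm⟩ := Subtype.ext hk
  rw [map_sub, map_sub, key, key, AddSubgroup.coe_sub, map_sub]

/-- Executing a word after the word of a kernel element only adds the production of the latter. -/
theorem exec_wordOf_append (k : (Σ v, A v) → ℕ) (hk : (fun a => (k a : ℤ)) ∈ N.totalKernel)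
    (w : List (Σ v, A v)) (x : (Σ v, A v) → ℤ) :
    N.exec (wordOf k ++ w) (x + fun a => (k a : ℤ), q) =
      ((N.exec w (x, q)).1 + N.production hq ⟨_, hk⟩, (N.exec w (x, q)).2) := by
  rw [exec_append, add_comm, exec_shift, ← localAct_zero, localAct_eq_production hq k hk]
  simp only
  rw [add_comm, exec_shift]

/-- Two inputs with the same image in `Crit N` differ by an element of `(I - P) K`. -/
theorem sub_mem_range_of_toCrit_eq (hirr : N.IsIrreducible) (hN : N.HaltsOnAllInputs)
    {x y : (Σ v, A v) → ℕ}
    (h : toCrit hN (fun a => (x a : ℤ)) = toCrit hN (fun a => (y a : ℤ))) :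
    ((fun a => (x a : ℤ)) - fun a => (y a : ℤ)) ∈
      (N.totalKernel.subtype - N.production hq).range := by
  classical
  obtain ⟨z, hz⟩ := exists_globalAct_eq_of_toCrit_eq hN h q
  obtain ⟨w, hwl, hwc⟩ := hN (z + x) q
  obtain ⟨w', hwl', hwc'⟩ := hN (z + y) q
  rw [globalAct_eq hN _ q w hwl hwc, globalAct_eq hN _ q w' hwl' hwc'] at hz
  have h0 : (N.exec w (fun a => (((z + x) a : ℕ) : ℤ), q)).1 = 0 :=
    le_antisymm hwc (N.exec_nonneg _ _ (fun a => Int.natCast_nonneg _) hwl)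
  have h0' : (N.exec w' (fun a => (((z + y) a : ℕ) : ℤ), q)).1 = 0 :=
    le_antisymm hwc' (N.exec_nonneg _ _ (fun a => Int.natCast_nonneg _) hwl')
  -- The vector found in `K` is the difference of the letter counts of the two executions, not of
  -- the inputs: equal final states mean that these counts act alike on `q` at every vertex.
  have hk : ((fun a => (w.count a : ℤ)) - fun a => (w'.count a : ℤ)) ∈ N.totalKernel := by
    refine hirr.sub_mem_totalKernel (q := q) fun v => ?_
    have := congrFun hz v
    rwa [exec_snd, exec_snd] at this
  obtain ⟨l, m, hl, hm, hlm⟩ := N.exists_diff _ hk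
  -- Prefixing by kernel words equalizes the letter counts, at the sole cost of the productions of
  -- `m` and `l`.
  have hp : (wordOf m ++ w).Perm (wordOf l ++ w') := by
    rw [List.perm_iff_count]
    intro a
    have := congrFun hlm a
    simp only [Pi.sub_apply] at this
    rw [List.count_append, List.count_append, count_wordOf, count_wordOf]
    omega
  have e1 := exec_wordOf_append hq m hm w (fun a => (((z + x) a : ℕ) : ℤ))
  have e2 := exec_wordOf_append hq l hl w' (fun a => (((z + y) a : ℕ) : ℤ))
  rw [h0, zero_add] at e1
  rw [h0', zero_add] at e2
  -- The two starting vectors differ by `x + m - y - l`. As execution commutes with translation, the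
  -- results `P(m)` and `P(l)` differ by the same vector.
  have hsplit : (fun a => (((z + x) a : ℕ) : ℤ)) + (fun a => (m a : ℤ)) =
      ((fun a => (((z + y) a : ℕ) : ℤ)) + fun a => (l a : ℤ)) +
        fun a => (x a : ℤ) + m a - y a - l a := by
    funext a
    simp only [Pi.add_apply]
    push_cast
    ring
  rw [N.exec_perm hp, hsplit, exec_shift, e2] at e1
  have e3 := congrArg Prod.fst e1
  refine ⟨⟨_, hl⟩ - ⟨_, hm⟩, ?_⟩
  funext a
  have e4 := congrFun e3 a
  simp only [Pi.add_apply] at e4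
  simp only [AddMonoidHom.sub_apply, map_sub, AddSubgroup.subtype_apply, Pi.sub_apply]
  linarith

/-- The positive and negative parts of an integer vector reduce one inclusion to comparing two
inputs in `ℕ^A`; the other is `φ ∘ P = φ` on `K`. -/
theorem ker_toCrit (hirr : N.IsIrreducible) (hN : N.HaltsOnAllInputs) :
    (toCrit hN).ker = (N.totalKernel.subtype - N.production hq).range := by
  refine le_antisymm (fun x hx => ?_) ?_
  · have hs : x = (fun a => ((x a).toNat : ℤ)) - fun a => ((-x a).toNat : ℤ) := by
      funext a
      simp only [Pi.sub_apply]
      omega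
    rw [hs]
    refine sub_mem_range_of_toCrit_eq hq hirr hN ?_
    rw [AddMonoidHom.mem_ker, hs, map_sub, sub_eq_zero] at hx
    exact hx
  · rintro _ ⟨k, rfl⟩
    rw [AddMonoidHom.mem_ker, AddMonoidHom.sub_apply, map_sub, toCrit_production hq hirr hN,
      AddSubgroup.subtype_apply, sub_self]

end Irreducible

end AbelianNetwork

/-- First isomorphism theorem for the surjection `φ`. The locally recurrent state `q` defining `P`
is arbitrary, so the argument never compares production maps of different states. -/
theorem theorem3p12 {V : Type*} [Fintype V] (G : Digraph V) (A Q : V → Type*)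
    [∀ v, Fintype (A v)] [∀ v, Finite (Q v)] (N : AbelianNetwork G A Q)
    (hirr : N.IsIrreducible) (hN : N.HaltsOnAllInputs)
    (q : ∀ v, Q v) (hq : N.LocallyRecurrent q) :
    ∃ Φ : (((Σ v, A v) → ℤ) ⧸ (N.totalKernel.subtype - N.production hq).range) ≃+
        Additive (AbelianNetwork.Crit hN),
      ∀ x : (Σ v, A v) → ℤ, Φ (QuotientAddGroup.mk x) = AbelianNetwork.toCrit hN x :=
  ⟨(QuotientAddGroup.quotientAddEquivOfEq (AbelianNetwork.ker_toCrit hq hirr hN).symm).trans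
    (QuotientAddGroup.quotientKerEquivOfSurjective _ (AbelianNetwork.toCrit_surjective hN)),
    fun _ => rfl⟩
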